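/- Let $\mathbb X$ be a Polish space with its Borel $\sigma$-algebra, and let $\Phi=\sum_{j}\delta_{X_j}$ be a simple point process on $\mathbb X$ with almost surely finitely many points. Attach to the points of $\Phi$ i.i.d. marks $S_j$ with law $H$ on $\mathbb R_+=[0,\infty)$, independent of the points, and put $\tilde\mu=\sum_j S_j\delta_{X_j}$, $\tilde p=\tilde\mu/\tilde\mu(\mathbb X)$, with $\tilde p:=0$ if $\tilde\mu(\mathbb X)=0$; in that case no observation is generated. Let $n\ge1$ and let $Y_1,\dots,Y_n$ be, given $\tilde p$ and on the event $\{\tilde\mu(\mathbb X)>0\}$, conditionally i.i.d. with law $\tilde p$. On this event let $K_n$ be the number of distinct values among $Y_1,\dots,Y_n$ and let $\mathbf Y^*=(Y^*_1,\dots,Y^*_{K_n})$ be the vector of these distinct values in order of first appearance. For $k\ge 0$ let $M_{\Phi^k}(B)=\mathsf E[\Phi^k(B)]$ be the $k$-th moment measure of $\Phi$ on $\mathbb X^k$, where $\Phi^k$ is the $k$-fold product measure $\Phi\otimes\cdots\otimes\Phi$, and assume that $M_{\Phi^k}$ is $\sigma$-finite. A family $(\mathbf P^{\mathbf y}_\Phi)_{\mathbf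 y\in\mathbb X^k}$ of $k$-th Palm distributions of $\Phi$ is a probability kernel from $\mathbb X^k$ to the space of measures on $\mathbb X$ such that $$\mathsf E\big[\Phi^k(B)\,\mathbf 1_L(\Phi)\big]=\int_B\mathbf P^{\mathbf y}_\Phi(L)\,M_{\Phi^k}(d\mathbf y)$$ for all measurable $B\subset\mathbb X^k$ and all measurable sets $L$ of measures. For such a family let $\Phi_{\mathbf y}\sim\mathbf P^{\mathbf y}_\Phi$, let $\Phi^!_{\mathbf y}=\Phi_{\mathbf y}-\sum_{j=1}^k\delta_{y_j}$ be the reduced Palm version of $\Phi$ at $\mathbf y$, and let $q_r(\mathbf y)=\mathsf P(\Phi^!_{\mathbf y}(\mathbb X)=r)$ for $r=0,1,2,\dots$. Put $$\psi(u)=\int_{\mathbb R_+}e^{-us}H(ds),\qquad \kappa(u,m)=\int_{\mathbb R_+}e^{-us}s^mH(ds),$$ $$V(n_1,\dots,n_k;r)=\int_0^\infty\frac{u^{n-1}}{\Gamma(n)}\,\psi(u)^r\prod_{j=1}^k\kappa(u,n_j)\,du\qquad(n_1+\dots+n_k=n).$$ Then $k$-th Palm distributions of $\Phi$ exist and, for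 every family of them, on the set of $k$-tuples $\mathbf y^*=(y_1^*,\dots,y_k^*)$ of pairwise distinct points, $$\mathsf P(K_n=k,\ \mathbf Y^*\in d\mathbf y^*)=\frac1{k!}\sum_{r=0}^\infty\Big(\sum_{\substack{n_1+\dots+n_k=n\\ n_1,\dots,n_k\ge1}}\binom{n}{n_1\cdots n_k}V(n_1,\dots,n_k;r)\Big)q_r(\mathbf y^*)\,M_{\Phi^k}(d\mathbf y^*).$$ That is, for every measurable $B\subset\mathbb X^k$, the probability of $\{\tilde\mu(\mathbb X)>0,\ K_n=k,\ \mathbf Y^*\in B\}$ is the integral of the right-hand side over the tuples in $B$ with pairwise distinct entries. -/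

import Mathlib

open MeasureTheory ProbabilityTheory Set
open scoped NNReal ENNReal

namespace NormalizedRandomMeasure

noncomputable section

/-! ### The distinct values of a sample -/

section Distinct

variable {X : Type*} {n : ℕ}

/-- The number `K_n` of distinct values in the sample `y = (y_1, …, y_n)`. -/
def numDistinct (y : Fin n → X) : ℕ := (Set.range y).ncard

open Classical in
/-- The indices at which a value shows up for the first time in `y`. -/
def firstOccurrences (y : Fin n → X) : Finset (Fin n) :=
  Finset.univ.filter fun i => ∀ j, j < i → y j ≠ y i

theorem card_firstOccurrences (y : Fin n → X) :
    (firstOccurrences y).card = numDistinct y := by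
  classical
  have himg : y '' (firstOccurrences y : Set (Fin n)) = Set.range y := by
    apply Set.Subset.antisymm (Set.image_subset_range _ _)
    rintro x ⟨i, rfl⟩
    have hne : (Finset.univ.filter fun j => y j = y i).Nonempty := ⟨i, by simp⟩
    have hm := Finset.min'_mem _ hne
    rw [Finset.mem_filter] at hm
    refine ⟨_, ?_, hm.2⟩
    simp only [firstOccurrences, Finset.coe_filter, Finset.mem_univ, true_and, Set.mem_ofPred_eq]
    intro j hj h
    have : (Finset.univ.filter fun j => y j = y i).min' hne ≤ j :=
      Finset.min'_le _ _ (by simp [h, hm.2])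
    exact absurd hj (not_lt.mpr this)
  have hinj : Set.InjOn y (firstOccurrences y : Set (Fin n)) := by
    intro i hi j hj h
    simp only [firstOccurrences, Finset.coe_filter, Finset.mem_univ, true_and,
      Set.mem_ofPred_eq] at hi hj
    rcases lt_trichotomy i j with hlt | heq | hgt
    · exact absurd h (hj i hlt)
    · exact heq
    · exact absurd h.symm (hi j hgt)
  rw [numDistinct, ← himg, hinj.ncard_image, Set.ncard_coe_finset]

/-- The vector `Y* = (Y*_1, …, Y*_{K_n})` of the distinct values of `y`, listed in order of
first appearance. -/
def distinctValues (y : Fin n → X) : Fin (numDistinct y) → X :=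
  fun j => y ((firstOccurrences y).orderEmbOfFin (card_firstOccurrences y) j)

/-- `K_n = k` and `Y* ∈ B`, for a sample `y` and a set `B` of `k`-tuples. -/
def DistinctValuesMem (k : ℕ) (B : Set (Fin k → X)) (y : Fin n → X) : Prop :=
  ∃ h : k = numDistinct y, (fun j => distinctValues y (Fin.cast h j)) ∈ B

end Distinct

/-! ### Finite point processes, marks, and the random measures built from them -/

section Model

variable {Ω X : Type*} [MeasurableSpace X]

/-- The counting measure `Φ = ∑_{j < N} δ_{X_j}` of the finite configuration `X_0, …, X_{N-1}`.
The values `X_j` with `j ≥ N` play no role. -/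
def pointProcess (N : Ω → ℕ) (x : ℕ → Ω → X) (ω : Ω) : Measure X :=
  ∑ j ∈ Finset.range (N ω), Measure.dirac (x j ω)

/-- The random measure `μ̃ = ∑_{j < N} S_j δ_{X_j}`. -/
def randomMeasure (N : Ω → ℕ) (x : ℕ → Ω → X) (S : ℕ → Ω → ℝ≥0) (ω : Ω) : Measure X :=
  ∑ j ∈ Finset.range (N ω), S j ω • Measure.dirac (x j ω)

/-- The normalization `p̃ = μ̃ / μ̃(X)`; it is the zero measure where `μ̃(X) = 0`, because
`∞ * 0 = 0`. -/
def normalizedMeasure (N : Ω → ℕ) (x : ℕ → Ω → X) (S : ℕ → Ω → ℝ≥0) (ω : Ω) : Measure X :=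
  (randomMeasure N x S ω univ)⁻¹ • randomMeasure N x S ω

variable [MeasurableSpace Ω]

/-- `∑_{j < N} δ_{(X_j, S_j)}` is a simple finite point process `∑_{j < N} δ_{X_j}`, marked with
i.i.d. marks `S_j` of law `H` which are independent of the points. -/
structure IsMarkedPointProcess (P : Measure Ω) (H : Measure ℝ≥0)
    (N : Ω → ℕ) (x : ℕ → Ω → X) (S : ℕ → Ω → ℝ≥0) : Prop where
  measurable_card : Measurable N
  measurable_point : ∀ j, Measurable (x j)
  simple : ∀ᵐ ω ∂P, Set.InjOn (fun j => x j ω) (Set.Iio (N ω))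
  measurable_mark : ∀ j, Measurable (S j)
  law_mark : ∀ j, P.map (S j) = H
  indep_marks : iIndepFun S P
  indep_points_marks : IndepFun (fun ω => (N ω, fun j => x j ω)) (fun ω j => S j ω) P

/-- `Y_1, …, Y_n` are conditionally i.i.d. with law `p̃` given the random measure `p̃`, on the
event that `p̃` is not the zero measure. -/
structure IsConditionallyIIDSample {n : ℕ} (P : Measure Ω) (p : Ω → Measure X)
    (Y : Fin n → Ω → X) : Prop where
  measurable : ∀ i, Measurable (Y i)
  law : ∀ L : Set (Measure X), MeasurableSet L →
    ∀ A : Fin n → Set X, (∀ i, MeasurableSet (A i)) →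
      P {ω | p ω ∈ L ∧ p ω ≠ 0 ∧ ∀ i, Y i ω ∈ A i} =
        ∫⁻ ω in {ω | p ω ∈ L ∧ p ω ≠ 0}, ∏ i, p ω (A i) ∂P

/-! ### Moment measures and Palm distributions -/

/-- The `k`-th power `Φ^k`, a random measure on `k`-tuples. -/
def powerProcess (k : ℕ) (N : Ω → ℕ) (x : ℕ → Ω → X) (ω : Ω) : Measure (Fin k → X) :=
  Measure.pi fun _ => pointProcess N x ω

/-- The `k`-th moment measure `M_{Φ^k}(B) = E[Φ^k(B)]`, see `momentMeasure_apply`. -/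
def momentMeasure (P : Measure Ω) (k : ℕ) (N : Ω → ℕ) (x : ℕ → Ω → X) : Measure (Fin k → X) :=
  P.bind (powerProcess k N x)

instance isFiniteMeasure_pointProcess (N : Ω → ℕ) (x : ℕ → Ω → X) (ω : Ω) :
    IsFiniteMeasure (pointProcess N x ω) := by
  refine ⟨?_⟩
  simp [pointProcess]

theorem measurable_pointProcess {N : Ω → ℕ} {x : ℕ → Ω → X} (hN : Measurable N)
    (hx : ∀ j, Measurable (x j)) : Measurable (pointProcess N x) := by
  refine Measure.measurable_of_measurable_coe _ fun s hs => ?_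
  have h : Measurable (Function.uncurry fun (m : ℕ) (ω : Ω) =>
      ∑ j ∈ Finset.range m, Measure.dirac (x j ω) s) :=
    measurable_from_prod_countable_right fun m => by
      simp only [Function.uncurry]
      exact Finset.measurable_fun_sum (Finset.range m) fun j _ =>
        (Measure.measurable_coe hs).comp (Measure.measurable_dirac.comp (hx j))
  have h2 := h.comp (hN.prodMk measurable_id)
  simpa [pointProcess, Function.comp_def, Function.uncurry] using h2

theorem measurable_powerProcess {k : ℕ} {N : Ω → ℕ} {x : ℕ → Ω → X} (hN : Measurable N)
    (hx : ∀ j, Measurable (x j)) : Measurable (powerProcess k N x) := by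
  have : ∀ ω, IsFiniteMeasure (powerProcess k N x ω) := fun ω => by
    unfold powerProcess; infer_instance
  refine Measurable.measure_of_isPiSystem generateFrom_pi.symm isPiSystem_pi ?_ ?_
  · rintro _ ⟨s, hs, rfl⟩
    simp only [powerProcess, Measure.pi_pi]
    exact Finset.measurable_fun_prod _ fun i _ =>
      (Measure.measurable_coe (hs i (mem_univ i))).comp (measurable_pointProcess hN hx)
  · simp only [powerProcess, Measure.pi_univ]
    exact Finset.measurable_fun_prod _ fun i _ =>
      (Measure.measurable_coe MeasurableSet.univ).comp (measurable_pointProcess hN hx)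

theorem momentMeasure_apply {P : Measure Ω} {k : ℕ} {N : Ω → ℕ} {x : ℕ → Ω → X}
    (hN : Measurable N) (hx : ∀ j, Measurable (x j)) {B : Set (Fin k → X)}
    (hB : MeasurableSet B) :
    momentMeasure P k N x B = ∫⁻ ω, powerProcess k N x ω B ∂P :=
  Measure.bind_apply hB (measurable_powerProcess hN hx).aemeasurable

/-- A family of `k`-th Palm distributions of `Φ`: a probability kernel that disintegrates the
`k`-th Campbell measure `C^k(B × L) = E[Φ^k(B); Φ ∈ L]` with respect to `M_{Φ^k}`. -/
structure IsPalmKernel (P : Measure Ω) (k : ℕ) (N : Ω → ℕ) (x : ℕ → Ω → X)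
    (palm : Kernel (Fin k → X) (Measure X)) : Prop where
  isMarkovKernel : IsMarkovKernel palm
  disintegration : ∀ B : Set (Fin k → X), MeasurableSet B →
    ∀ L : Set (Measure X), MeasurableSet L →
      ∫⁻ ω in {ω | pointProcess N x ω ∈ L}, powerProcess k N x ω B ∂P =
        ∫⁻ y in B, palm y L ∂(momentMeasure P k N x)

/-- `q_r = P(Φ^!_y(X) = r)`, where `Φ^!_y = Φ_y - ∑_j δ_{y_j}` is the reduced Palm version of `Φ`
at `y` and `Φ_y` has the Palm distribution at `y`. -/
def reducedPalmCount {k : ℕ} (palm : Kernel (Fin k → X) (Measure X)) (y : Fin k → X)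
    (r : ℕ) : ℝ≥0∞ :=
  palm y {ν | (ν - ∑ j, Measure.dirac (y j)) univ = r}

end Model

/-! ### The mixing weights -/

/-- `ψ(u) = ∫ e^{-us} H(ds)`. -/
def psi (H : Measure ℝ≥0) (u : ℝ) : ℝ≥0∞ :=
  ∫⁻ s, ENNReal.ofReal (Real.exp (-u * s)) ∂H

/-- `κ(u, m) = ∫ e^{-us} s^m H(ds)`. -/
def kappa (H : Measure ℝ≥0) (u : ℝ) (m : ℕ) : ℝ≥0∞ :=
  ∫⁻ s, ENNReal.ofReal (Real.exp (-u * s) * (s : ℝ) ^ m) ∂H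

/-- `V(n_1, …, n_k; r) = ∫_0^∞ u^{n-1} / Γ(n) ψ(u)^r ∏_j κ(u, n_j) du`, used for
`n = n_1 + ⋯ + n_k ≥ 1`. -/
def mixingWeight (H : Measure ℝ≥0) (n : ℕ) {k : ℕ} (c : Fin k → ℕ) (r : ℕ) : ℝ≥0∞ :=
  ∫⁻ u in Set.Ioi (0 : ℝ),
    ENNReal.ofReal (u ^ (n - 1) / Real.Gamma n) * psi H u ^ r * ∏ j, kappa H u (c j)

/-- The vectors `(n_1, …, n_k)` of positive integers with `n_1 + ⋯ + n_k = n`. -/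
def positiveCompositions (n k : ℕ) : Finset (Fin k → ℕ) :=
  (Finset.piAntidiag Finset.univ n).filter fun c => ∀ j, 0 < c j

end

end NormalizedRandomMeasure

namespace NormalizedRandomMeasure

/-! ### Index maps, their blocks, and counting by block sizes -/

section Combinatorics

variable {X Z : Type*} {n k : ℕ}

/-! Given points and marks, sampling amounts to drawing a random index map. On `N = m`, with total
mark T > 0, the power p̃^n is the sum over g : Fin n → Fin m of the weight ∏ S_{g i} / T times the
Dirac mass at x ∘ g. As the points are a.s. distinct, the g with k values factor uniquely as e ∘ f,
where e is injective and f is an ordered surjection (a partition of the sample into k blocks), and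
then Y* = x ∘ e (`sum_ite_distinctValuesMem`).

Points and marks are independent, so (e, f) contributes P(N = m, x ∘ e ∈ B) times the mean weight.
Writing T^{-n} as the integral of u^{n-1} e^{-uT} / Γ(n) factorizes that mean over the marks: each
selected point gives κ(u, block size), each of the m - k others gives ψ(u). The result is V(block
sizes; m - k) (`lintegral_prod_inv_mul`, `mixingWeight_fiberCard_comp`). By symmetry of V, the sum
over ordered surjections is 1/k! times the sum over all surjections, and multinomial coefficients
count these by block sizes.

With m = r + k, the sum over e of P(N = m, x ∘ e ∈ B) is the mean of Φ^k on the distinct tuples in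
B, restricted to Φ(X) = r + k. The Palm kernel disintegrates it, and for almost every distinct tuple
y the Palm version dominates ∑ δ_{y_j}, so having r + k points means having r points after reduction
(`IsPalmKernel.ae_reducedPalmCount_eq`). -/

theorem distinctValuesMem_iff_orderEmbOfFin (B : Set (Fin k → X)) (y : Fin n → X) :
    DistinctValuesMem k B y ↔ ∃ h : (firstOccurrences y).card = k,
      (fun j => y ((firstOccurrences y).orderEmbOfFin h j)) ∈ B := by
  constructor
  · rintro ⟨rfl, hB⟩
    exact ⟨card_firstOccurrences y, hB⟩
  · rintro ⟨h, hB⟩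
    have hk : k = numDistinct y := h.symm.trans (card_firstOccurrences y)
    subst hk
    exact ⟨rfl, hB⟩

theorem firstOccurrences_comp {e : Z → X} (he : Function.Injective e) (f : Fin n → Z) :
    firstOccurrences (e ∘ f) = firstOccurrences f := by
  ext i
  simp [firstOccurrences, he.eq_iff]

theorem distinctValuesMem_comp {e : Z → X} (he : Function.Injective e) (f : Fin n → Z)
    (B : Set (Fin k → X)) :
    DistinctValuesMem k B (e ∘ f) ↔ DistinctValuesMem k {a | e ∘ a ∈ B} f := by
  simp only [distinctValuesMem_iff_orderEmbOfFin, firstOccurrences_comp he]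
  rfl

theorem DistinctValuesMem.mono {B C : Set (Fin k → X)} {y : Fin n → X}
    (h : DistinctValuesMem k B y) (hBC : B ⊆ C) : DistinctValuesMem k C y :=
  h.imp fun _ hB => hBC hB

theorem DistinctValuesMem.eq_of_singleton {a b : Fin k → X} {y : Fin n → X}
    (ha : DistinctValuesMem k {a} y) (hb : DistinctValuesMem k {b} y) : a = b := by
  obtain ⟨_, ha⟩ := ha
  obtain ⟨_, hb⟩ := hb
  exact (Set.mem_singleton_iff.mp ha).symm.trans (Set.mem_singleton_iff.mp hb)

theorem exists_comp_eq_of_distinctValuesMem {B : Set (Fin k → X)} {y : Fin n → X}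
    (h : DistinctValuesMem k B y) :
    ∃ a ∈ B, Function.Injective a ∧ DistinctValuesMem k {a} y ∧
      ∃ f : Fin n → Fin k, a ∘ f = y := by
  classical
  rw [distinctValuesMem_iff_orderEmbOfFin] at h
  obtain ⟨h, hB⟩ := h
  have hmem := (firstOccurrences y).orderEmbOfFin_mem h
  refine ⟨_, hB, ?_, ?_, ?_⟩
  · intro i j hij
    have hi := hmem i
    have hj := hmem j
    simp only [firstOccurrences, Finset.mem_filter, Finset.mem_univ, true_and] at hi hj
    rcases lt_trichotomy i j with hlt | heq | hgt
    · exact absurd hij (hj _ (((firstOccurrences y).orderEmbOfFin h).strictMono hlt))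
    · exact heq
    · exact absurd hij.symm (hi _ (((firstOccurrences y).orderEmbOfFin h).strictMono hgt))
  · rw [distinctValuesMem_iff_orderEmbOfFin]
    exact ⟨h, rfl⟩
  · have : ∀ i, ∃ j, y ((firstOccurrences y).orderEmbOfFin h j) = y i := by
      intro i
      have hne : (Finset.univ.filter fun j => y j = y i).Nonempty := ⟨i, by simp⟩
      have hm := Finset.min'_mem _ hne
      rw [Finset.mem_filter] at hm
      have hfo : (Finset.univ.filter fun j => y j = y i).min' hne ∈ firstOccurrences y := by
        simp only [firstOccurrences, Finset.mem_filter, Finset.mem_univ, true_and]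
        intro j hj hji
        exact absurd hj (not_lt.mpr (Finset.min'_le _ _ (by simp [hji, hm.2])))
      rw [← Finset.mem_coe, ← Finset.range_orderEmbOfFin _ h] at hfo
      obtain ⟨j, hj⟩ := hfo
      exact ⟨j, by rw [hj, hm.2]⟩
    choose f hf using this
    exact ⟨f, funext hf⟩

/-- The maps `Fin n → Fin k` whose values appear in the order `0, 1, …, k - 1`. They encode the
partitions of `Fin n` into `k` blocks. -/
def IsOrderedSurjection (f : Fin n → Fin k) : Prop := DistinctValuesMem k {id} f

theorem IsOrderedSurjection.surjective {f : Fin n → Fin k} (hf : IsOrderedSurjection f) :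
    Function.Surjective f := by
  rw [IsOrderedSurjection, distinctValuesMem_iff_orderEmbOfFin] at hf
  obtain ⟨h, hf⟩ := hf
  intro j
  exact ⟨_, congrFun hf j⟩

theorem isOrderedSurjection_iff_comp {a : Fin k → X} (ha : Function.Injective a)
    (f : Fin n → Fin k) : DistinctValuesMem k {a} (a ∘ f) ↔ IsOrderedSurjection f := by
  rw [distinctValuesMem_comp ha, IsOrderedSurjection]
  have : {b : Fin k → Fin k | a ∘ b ∈ ({a} : Set (Fin k → X))} = {id} := by
    ext b
    simp only [Set.mem_singleton_iff, Set.mem_ofPred_eq]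
    exact ⟨fun h => funext fun j => ha (congrFun h j), fun h => by simp [h]⟩
  rw [this]

theorem distinctValuesMem_iff_exists_comp (B : Set (Fin k → X)) (y : Fin n → X) :
    DistinctValuesMem k B y ↔ ∃ a ∈ B, Function.Injective a ∧
      ∃ f : Fin n → Fin k, IsOrderedSurjection f ∧ a ∘ f = y := by
  constructor
  · intro h
    obtain ⟨a, haB, ha, hay, f, rfl⟩ := exists_comp_eq_of_distinctValuesMem h
    exact ⟨a, haB, ha, f, (isOrderedSurjection_iff_comp ha f).mp hay, rfl⟩
  · rintro ⟨a, haB, ha, f, hf, rfl⟩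
    exact ((isOrderedSurjection_iff_comp ha f).mpr hf).mono (Set.singleton_subset_iff.mpr haB)

/-- Both a and b are the vector of distinct values of the common composite, hence equal; injectivity
then cancels a. This is the uniqueness behind both bijective counts below. -/
theorem comp_eq_comp_iff_of_isOrderedSurjection {a b : Fin k → X} (ha : Function.Injective a)
    (hb : Function.Injective b) {f g : Fin n → Fin k} (hf : IsOrderedSurjection f)
    (hg : IsOrderedSurjection g) (h : a ∘ f = b ∘ g) : a = b ∧ f = g := by
  have h1 := (isOrderedSurjection_iff_comp ha f).mpr hf
  have h2 := (isOrderedSurjection_iff_comp hb g).mpr hg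
  rw [← h] at h2
  obtain rfl := h1.eq_of_singleton h2
  exact ⟨rfl, funext fun i => ha (congrFun h i)⟩

theorem measurableSet_injective [TopologicalSpace X] [PolishSpace X] [MeasurableSpace X]
    [BorelSpace X] : MeasurableSet {a : Fin k → X | Function.Injective a} := by
  simp only [Function.Injective, Set.ofPred_forall]
  refine MeasurableSet.iInter fun i => MeasurableSet.iInter fun j => ?_
  by_cases hij : i = j
  · simp [hij]
  · simp only [hij, imp_false]
    exact (measurableSet_eq_fun (measurable_pi_apply i) (measurable_pi_apply j)).compl

theorem measurableSet_distinctValuesMem [TopologicalSpace X] [PolishSpace X] [MeasurableSpace X]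
    [BorelSpace X] {B : Set (Fin k → X)} (hB : MeasurableSet B) :
    MeasurableSet {y : Fin n → X | DistinctValuesMem k B y} := by
  -- A finite union over partitions f: a tuple has pattern f exactly when it is recovered, through
  -- f, from its values at one chosen index per block, and these values are distinct.
  have : {y : Fin n → X | DistinctValuesMem k B y} =
      ⋃ f : {f : Fin n → Fin k // IsOrderedSurjection f},
        {y | y ∘ Function.surjInv f.2.surjective ∈ B ∩ {a | Function.Injective a}} ∩
          {y | (y ∘ Function.surjInv f.2.surjective) ∘ f.1 = y} := by
    ext y
    simp only [Set.mem_ofPred_eq, Set.mem_iUnion, Set.mem_inter_iff]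
    rw [distinctValuesMem_iff_exists_comp]
    constructor
    · rintro ⟨a, haB, ha, f, hf, rfl⟩
      have hs : (a ∘ f) ∘ Function.surjInv hf.surjective = a := by
        funext j
        simp [Function.surjInv_eq hf.surjective]
      refine ⟨⟨f, hf⟩, ?_⟩
      simp only [hs]
      exact ⟨⟨haB, ha⟩, trivial⟩
    · rintro ⟨⟨f, hf⟩, ⟨h1, h2⟩, h3⟩
      exact ⟨_, h1, h2, f, hf, h3⟩
  rw [this]
  refine MeasurableSet.iUnion fun f => MeasurableSet.inter ?_ ?_
  · exact (measurable_pi_lambda _ fun j => measurable_pi_apply _) (hB.inter measurableSet_injective)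
  · exact measurableSet_eq_fun (measurable_pi_lambda _ fun j => measurable_pi_apply _)
      measurable_id

/-- The sizes of the fibres of `f`. -/
def fiberCard (f : Fin n → Fin k) (j : Fin k) : ℕ := (Finset.univ.filter fun i => f i = j).card

theorem prod_comp_eq_prod_pow_fiberCard {M : Type*} [CommMonoid M] (f : Fin n → Fin k)
    (s : Fin k → M) : ∏ i, s (f i) = ∏ j, s j ^ fiberCard f j := by
  rw [← Finset.prod_fiberwise Finset.univ f]
  refine Finset.prod_congr rfl fun j _ => ?_
  rw [fiberCard, Finset.prod_congr rfl (g := fun _ => s j), Finset.prod_const]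
  intro i hi
  rw [(Finset.mem_filter.mp hi).2]

theorem sum_fiberCard (f : Fin n → Fin k) : ∑ j, fiberCard f j = n := by
  simpa [fiberCard] using (Finset.card_eq_sum_card_fiberwise (s := Finset.univ)
    (t := Finset.univ) (f := f) (by simp)).symm

theorem fiberCard_pos {f : Fin n → Fin k} (hf : Function.Surjective f) (j : Fin k) :
    0 < fiberCard f j := by
  obtain ⟨i, hi⟩ := hf j
  exact Finset.card_pos.mpr ⟨i, by simp [hi]⟩

theorem fiberCard_mem_positiveCompositions_iff (f : Fin n → Fin k) :
    fiberCard f ∈ positiveCompositions n k ↔ Function.Surjective f := by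
  simp only [positiveCompositions, Finset.mem_filter, Finset.mem_piAntidiag, sum_fiberCard,
    Finset.mem_univ, implies_true, true_and]
  refine ⟨fun h j => ?_, fiberCard_pos⟩
  obtain ⟨i, hi⟩ := Finset.card_pos.mp (h j)
  exact ⟨i, by simpa using hi⟩

/-- Compare the coefficient of X^c in (X_1 + ⋯ + X_k)^n, expanded by the multinomial theorem and by
distributivity over all maps. -/
theorem card_fiberCard_eq {c : Fin k → ℕ} (hc : ∑ j, c j = n) :
    (Finset.univ.filter fun f : Fin n → Fin k => fiberCard f = c).card =
      Nat.multinomial Finset.univ c := by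
  classical
  have hmon : ∀ d : Fin k → ℕ, ∏ j, (MvPolynomial.X j : MvPolynomial (Fin k) ℕ) ^ d j =
      MvPolynomial.monomial (Finsupp.equivFunOnFinite.symm d) 1 := by
    intro d
    rw [MvPolynomial.monomial_eq, Finsupp.prod_fintype _ _ (by simp)]
    simp
  have h1 : (∑ j, (MvPolynomial.X j : MvPolynomial (Fin k) ℕ)) ^ n =
      ∑ f : Fin n → Fin k, MvPolynomial.monomial (Finsupp.equivFunOnFinite.symm (fiberCard f)) 1 := by
    have := Finset.prod_univ_sum (fun _ : Fin n => (Finset.univ : Finset (Fin k)))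
      (fun _ j => (MvPolynomial.X j : MvPolynomial (Fin k) ℕ))
    rw [Finset.prod_const, Finset.card_univ, Fintype.card_fin, Fintype.piFinset_univ] at this
    rw [this]
    refine Finset.sum_congr rfl fun f _ => ?_
    rw [prod_comp_eq_prod_pow_fiberCard f fun j => MvPolynomial.X j, hmon]
  rw [Finset.sum_pow_eq_sum_piAntidiag] at h1
  simp only [hmon] at h1
  have h2 := congrArg (MvPolynomial.coeff (Finsupp.equivFunOnFinite.symm c)) h1
  simp only [← MvPolynomial.C_eq_coe_nat, MvPolynomial.coeff_sum, MvPolynomial.coeff_C_mul,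
    MvPolynomial.coeff_monomial,
    EmbeddingLike.apply_eq_iff_eq, mul_ite, mul_one, mul_zero] at h2
  rw [Finset.sum_ite_eq', if_pos (by simp [hc])] at h2
  simpa using h2.symm

theorem sum_surjective_eq_sum_positiveCompositions {M : Type*} [CommSemiring M]
    (W : (Fin k → ℕ) → M) :
    (∑ c ∈ positiveCompositions n k, (Nat.multinomial Finset.univ c : M) * W c) =
      ∑ f : Fin n → Fin k with Function.Surjective f, W (fiberCard f) := by
  classical
  rw [← Finset.sum_fiberwise_of_maps_to (t := positiveCompositions n k) (g := fiberCard)]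
  · refine Finset.sum_congr rfl fun c hc => ?_
    have hc' := (Finset.mem_piAntidiag.mp (Finset.mem_filter.mp hc).1).1
    rw [← card_fiberCard_eq hc', ← nsmul_eq_mul, ← Finset.sum_const, Finset.filter_filter]
    refine Finset.sum_congr ?_ fun f hf => by rw [(Finset.mem_filter.mp hf).2.2]
    · ext f
      simp only [Finset.mem_filter, Finset.mem_univ, true_and]
      refine ⟨fun h => ⟨?_, h⟩, fun h => h.2⟩
      rw [← fiberCard_mem_positiveCompositions_iff, h]
      exact hc
  · intro f hf
    exact (fiberCard_mem_positiveCompositions_iff f).mpr (Finset.mem_filter.mp hf).2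

theorem fiberCard_comp_perm (σ : Equiv.Perm (Fin k)) (f : Fin n → Fin k) :
    fiberCard (σ ∘ f) = fiberCard f ∘ σ.symm := by
  funext j
  simp [fiberCard, Equiv.eq_symm_apply]

open Classical in
-- Every surjection is σ ∘ f for a unique permutation σ and a unique ordered surjection f, and σ
-- only permutes the block sizes.
theorem sum_surjective_eq_factorial_mul {M : Type*} [CommSemiring M] (W : (Fin k → ℕ) → M)
    (hW : ∀ (σ : Equiv.Perm (Fin k)) c, W (c ∘ σ) = W c) :
    ∑ f : Fin n → Fin k with Function.Surjective f, W (fiberCard f) =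
      (k.factorial : M) * ∑ f : Fin n → Fin k with IsOrderedSurjection f, W (fiberCard f) := by
  have hcard : (k.factorial : M) = ∑ σ : Equiv.Perm (Fin k), 1 := by
    simp [Fintype.card_perm]
  rw [hcard, Finset.sum_mul_sum, ← Finset.sum_product']
  symm
  refine Finset.sum_bij (fun q _ => q.1 ∘ q.2) ?_ ?_ ?_ ?_
  · rintro ⟨σ, f⟩ h
    simp only [Finset.mem_product, Finset.mem_filter, Finset.mem_univ, true_and] at h ⊢
    exact σ.surjective.comp h.surjective
  · rintro ⟨σ, f⟩ h ⟨τ, g⟩ h' heq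
    simp only [Finset.mem_product, Finset.mem_filter, Finset.mem_univ, true_and] at h h'
    obtain ⟨h1, h2⟩ := comp_eq_comp_iff_of_isOrderedSurjection σ.injective τ.injective h h' heq
    simp only [DFunLike.coe_fn_eq] at h1
    rw [h1, h2]
  · intro f hf
    simp only [Finset.mem_filter, Finset.mem_univ, true_and] at hf
    have hD : DistinctValuesMem k Set.univ f :=
      ⟨by simp [numDistinct, hf.range_eq], trivial⟩
    rw [distinctValuesMem_iff_exists_comp] at hD
    obtain ⟨a, -, ha, g, hg, rfl⟩ := hD
    exact ⟨(Equiv.ofBijective a (Finite.injective_iff_bijective.mp ha), g), by simp [hg], rfl⟩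
  · rintro ⟨σ, f⟩ h
    rw [one_mul, fiberCard_comp_perm, hW]

end Combinatorics

/-! ### Powers of purely atomic measures and the law of the sample -/

section DiscreteMeasures

variable {Ω X : Type*} [MeasurableSpace X]

theorem isFiniteMeasure_sum_smul_dirac {κ : Type*} [Fintype κ] {w : κ → ℝ≥0∞}
    (hw : ∀ a, w a ≠ ∞) (x : κ → X) : IsFiniteMeasure (∑ a, w a • Measure.dirac (x a)) := by
  refine ⟨?_⟩
  simpa [lt_top_iff_ne_top] using hw

theorem pi_sum_smul_dirac {ι κ : Type*} [Fintype ι] [DecidableEq ι] [Fintype κ] {w : κ → ℝ≥0∞}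
    (hw : ∀ a, w a ≠ ∞) (x : κ → X) :
    (Measure.pi fun _ : ι => ∑ a, w a • Measure.dirac (x a)) =
      ∑ g : ι → κ, (∏ i, w (g i)) • Measure.dirac (x ∘ g) := by
  classical
  have := isFiniteMeasure_sum_smul_dirac hw x
  refine Measure.pi_eq fun s hs => ?_
  have hdirac : ∀ g : ι → κ, Measure.dirac (x ∘ g) (Set.univ.pi s) =
      ∏ i, (Measure.dirac (x (g i)) (s i) : ℝ≥0∞) := by
    intro g
    rw [Measure.dirac_apply' _ (MeasurableSet.univ_pi hs)]
    simp only [Measure.dirac_apply' _ (hs _), Set.indicator_apply, Set.mem_univ_pi,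
      Function.comp_apply, Pi.one_apply]
    rw [Finset.prod_ite_zero]
    simp
  simp only [Measure.finsetSum_apply, Measure.smul_apply, smul_eq_mul, hdirac]
  rw [Finset.prod_univ_sum, Fintype.piFinset_univ]
  simp only [Finset.prod_mul_distrib]

theorem powerProcess_eq (k : ℕ) (N : Ω → ℕ) (x : ℕ → Ω → X) (ω : Ω) :
    powerProcess k N x ω =
      ∑ e : Fin k → Fin (N ω), Measure.dirac (fun i => x (e i) ω) := by
  have h := pi_sum_smul_dirac (ι := Fin k) (κ := Fin (N ω)) (w := fun _ => 1) (by simp)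
    (fun j => x j ω)
  simp only [one_smul, Finset.prod_const_one] at h
  rw [powerProcess, pointProcess, Finset.sum_range, h]
  rfl

theorem pointProcess_univ (N : Ω → ℕ) (x : ℕ → Ω → X) (ω : Ω) :
    pointProcess N x ω univ = N ω := by
  simp [pointProcess]

theorem randomMeasure_univ (N : Ω → ℕ) (x : ℕ → Ω → X) (S : ℕ → Ω → ℝ≥0) (ω : Ω) :
    randomMeasure N x S ω univ = ∑ j : Fin (N ω), (S j ω : ℝ≥0∞) := by
  rw [randomMeasure, Finset.sum_range]
  simp only [Measure.finsetSum_apply, Measure.smul_apply, measure_univ]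
  simp [ENNReal.smul_def]

theorem randomMeasure_univ_ne_top (N : Ω → ℕ) (x : ℕ → Ω → X) (S : ℕ → Ω → ℝ≥0) (ω : Ω) :
    randomMeasure N x S ω univ ≠ ∞ := by
  simp [randomMeasure_univ]

theorem normalizedMeasure_ne_zero_iff (N : Ω → ℕ) (x : ℕ → Ω → X) (S : ℕ → Ω → ℝ≥0) (ω : Ω) :
    normalizedMeasure N x S ω ≠ 0 ↔ 0 < randomMeasure N x S ω univ := by
  rw [pos_iff_ne_zero, ← Measure.measure_univ_ne_zero, normalizedMeasure, Measure.smul_apply,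
    smul_eq_mul, mul_ne_zero_iff, ENNReal.inv_ne_zero]
  exact ⟨fun h => h.2, fun h => ⟨randomMeasure_univ_ne_top N x S ω, h⟩⟩

theorem normalizedMeasure_univ_le (N : Ω → ℕ) (x : ℕ → Ω → X) (S : ℕ → Ω → ℝ≥0) (ω : Ω) :
    normalizedMeasure N x S ω univ ≤ 1 := by
  rw [normalizedMeasure, Measure.smul_apply, smul_eq_mul]
  exact ENNReal.inv_mul_le_one _

theorem pi_normalizedMeasure (n : ℕ) (N : Ω → ℕ) (x : ℕ → Ω → X) (S : ℕ → Ω → ℝ≥0) {ω : Ω}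
    (hω : 0 < randomMeasure N x S ω univ) :
    (Measure.pi fun _ : Fin n => normalizedMeasure N x S ω) =
      ∑ g : Fin n → Fin (N ω),
        (∏ i, ((∑ j : Fin (N ω), (S j ω : ℝ≥0∞))⁻¹ * S (g i) ω)) •
          Measure.dirac (fun i => x (g i) ω) := by
  have hT : (∑ j : Fin (N ω), (S j ω : ℝ≥0∞))⁻¹ ≠ ∞ := by
    rw [← randomMeasure_univ N x S ω]
    exact ENNReal.inv_ne_top.mpr hω.ne'
  have h := pi_sum_smul_dirac (ι := Fin n) (κ := Fin (N ω))
    (w := fun a => (∑ j : Fin (N ω), (S j ω : ℝ≥0∞))⁻¹ * S a ω)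
    (fun a => ENNReal.mul_ne_top hT ENNReal.coe_ne_top) (fun j => x j ω)
  have h2 : normalizedMeasure N x S ω =
      ∑ a : Fin (N ω), ((∑ j : Fin (N ω), (S j ω : ℝ≥0∞))⁻¹ * S a ω) •
        Measure.dirac (x a ω) := by
    rw [normalizedMeasure, randomMeasure_univ, randomMeasure, Finset.sum_range, Finset.smul_sum]
    simp only [mul_smul]
    rfl
  rw [h2, h]
  rfl

variable [MeasurableSpace Ω]

theorem measurable_randomMeasure {N : Ω → ℕ} {x : ℕ → Ω → X} {S : ℕ → Ω → ℝ≥0}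
    (hN : Measurable N) (hx : ∀ j, Measurable (x j)) (hS : ∀ j, Measurable (S j)) :
    Measurable (randomMeasure N x S) := by
  refine Measure.measurable_of_measurable_coe _ fun s hs => ?_
  have h : Measurable (Function.uncurry fun (m : ℕ) (ω : Ω) =>
      ∑ j ∈ Finset.range m, (S j ω : ℝ≥0∞) * Measure.dirac (x j ω) s) :=
    measurable_from_prod_countable_right fun m => by
      simp only [Function.uncurry]
      exact Finset.measurable_fun_sum (Finset.range m) fun j _ =>
        (hS j).coe_nnreal_ennreal.mul
          ((Measure.measurable_coe hs).comp (Measure.measurable_dirac.comp (hx j)))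
  have h2 := h.comp (hN.prodMk measurable_id)
  simp only [randomMeasure, Measure.finsetSum_apply, Measure.smul_apply]
  exact h2

theorem measurable_normalizedMeasure {N : Ω → ℕ} {x : ℕ → Ω → X} {S : ℕ → Ω → ℝ≥0}
    (hN : Measurable N) (hx : ∀ j, Measurable (x j)) (hS : ∀ j, Measurable (S j)) :
    Measurable (normalizedMeasure N x S) := by
  have h := measurable_randomMeasure hN hx hS
  refine Measure.measurable_of_measurable_coe _ fun s hs => ?_
  simp only [normalizedMeasure, Measure.smul_apply, smul_eq_mul]
  exact ((Measure.measurable_coe MeasurableSet.univ).comp h).inv.mul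
    ((Measure.measurable_coe hs).comp h)

theorem measurable_measure_pi {ι : Type*} [Fintype ι] {p : Ω → Measure X} (hp : Measurable p)
    (hp' : ∀ ω, IsFiniteMeasure (p ω)) : Measurable fun ω => Measure.pi fun _ : ι => p ω := by
  refine Measurable.measure_of_isPiSystem generateFrom_pi.symm isPiSystem_pi ?_ ?_
  · rintro _ ⟨s, hs, rfl⟩
    simp only [Measure.pi_pi]
    exact Finset.measurable_fun_prod _ fun i _ =>
      (Measure.measurable_coe (hs i (mem_univ i))).comp hp
  · simp only [Measure.pi_univ]
    exact Finset.measurable_fun_prod _ fun i _ =>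
      (Measure.measurable_coe MeasurableSet.univ).comp hp

/-- Two finite measures on n-tuples that agree on the π-system of boxes agree on all measurable
sets. -/
theorem IsConditionallyIIDSample.measure_mem {P : Measure Ω} [IsFiniteMeasure P] {n : ℕ}
    {p : Ω → Measure X} {Y : Fin n → Ω → X} (hY : IsConditionallyIIDSample P p Y)
    (hp : Measurable p) (hp' : ∀ ω, IsFiniteMeasure (p ω)) {D : Set (Fin n → X)}
    (hD : MeasurableSet D) :
    P {ω | p ω ≠ 0 ∧ (fun i => Y i ω) ∈ D} =
      ∫⁻ ω in {ω | p ω ≠ 0}, (Measure.pi fun _ => p ω) D ∂P := by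
  have hne : MeasurableSet {ω | p ω ≠ 0} := by
    simp only [← Measure.measure_univ_ne_zero]
    exact ((Measure.measurable_coe MeasurableSet.univ).comp hp)
      (MeasurableSet.singleton (0 : ℝ≥0∞)).compl
  have hYm : Measurable fun ω i => Y i ω := measurable_pi_lambda _ hY.measurable
  have hpi := measurable_measure_pi (ι := Fin n) hp hp'
  have key : (P.restrict {ω | p ω ≠ 0}).map (fun ω i => Y i ω) =
      (P.restrict {ω | p ω ≠ 0}).bind fun ω => Measure.pi fun _ => p ω := by
    have hrect : ∀ A : Fin n → Set X, (∀ i, MeasurableSet (A i)) →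
        (P.restrict {ω | p ω ≠ 0}).map (fun ω i => Y i ω) (Set.univ.pi A) =
          (P.restrict {ω | p ω ≠ 0}).bind (fun ω => Measure.pi fun _ => p ω)
            (Set.univ.pi A) := by
      intro A hA
      have hAm := MeasurableSet.univ_pi hA
      rw [Measure.map_apply hYm hAm, Measure.restrict_apply (hYm hAm),
        Measure.bind_apply hAm hpi.aemeasurable]
      have h := hY.law univ MeasurableSet.univ A hA
      simp only [mem_univ, true_and] at h
      simp only [Measure.pi_pi]
      rw [← h]
      congr 1
      ext ω
      simp [and_comm]
    refine ext_of_generate_finite _ generateFrom_pi.symm isPiSystem_pi ?_ ?_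
    · rintro _ ⟨A, hA, rfl⟩
      exact hrect A fun i => hA i (mem_univ i)
    · simpa using hrect (fun _ => univ) fun _ => MeasurableSet.univ
  have h := congrArg (fun μ => μ D) key
  rw [Measure.map_apply hYm hD, Measure.restrict_apply (hYm hD),
    Measure.bind_apply hD hpi.aemeasurable] at h
  rw [← h]
  congr 1
  ext ω
  simp [and_comm]

end DiscreteMeasures

/-! ### Averaging the weights over the marks -/

section Marks

theorem lintegral_pow_mul_exp_neg_div_Gamma {n : ℕ} (hn : 1 ≤ n) {T : ℝ} (hT : 0 < T) :
    ∫⁻ u in Ioi (0 : ℝ), ENNReal.ofReal (u ^ (n - 1) / Real.Gamma n) *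
      ENNReal.ofReal (Real.exp (-u * T)) = (ENNReal.ofReal T)⁻¹ ^ n := by
  have hn' : (0 : ℝ) < n := by exact_mod_cast hn
  have hΓ := Real.Gamma_pos_of_pos hn'
  have hval : ∫ u in Ioi (0 : ℝ), u ^ (n - 1) / Real.Gamma n * Real.exp (-u * T) =
      T⁻¹ ^ n := by
    have h := Real.integral_rpow_mul_exp_neg_mul_Ioi hn' hT
    rw [Real.rpow_natCast, one_div] at h
    rw [← mul_div_cancel_right₀ (T⁻¹ ^ n) hΓ.ne', ← h, ← integral_div]
    refine setIntegral_congr_fun measurableSet_Ioi fun u _ => ?_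
    have : (n : ℝ) - 1 = ((n - 1 : ℕ) : ℝ) := by push_cast [hn]; ring
    rw [this, Real.rpow_natCast, neg_mul, mul_comm u T]
    ring
  have hint : IntegrableOn
      (fun u : ℝ => u ^ (n - 1) / Real.Gamma n * Real.exp (-u * T)) (Ioi 0) := by
    -- The Bochner integral of a non-integrable function is 0, whereas the value found above is
    -- positive.
    by_contra h
    rw [integral_undef h] at hval
    exact (pow_pos (inv_pos.mpr hT) n).ne hval
  rw [← ENNReal.inv_pow, ← ENNReal.ofReal_pow hT.le, ← ENNReal.ofReal_inv_of_pos (pow_pos hT n),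
    ← inv_pow, ← hval, ofReal_integral_eq_lintegral_ofReal hint]
  · refine setLIntegral_congr_fun measurableSet_Ioi fun u hu => ?_
    exact (ENNReal.ofReal_mul (div_nonneg (pow_nonneg (le_of_lt hu) _) hΓ.le)).symm
  · refine (ae_restrict_iff' measurableSet_Ioi).mpr (Filter.Eventually.of_forall fun u hu => ?_)
    exact mul_nonneg (div_nonneg (pow_nonneg (le_of_lt hu) _) hΓ.le) (Real.exp_pos _).le

theorem prod_inv_mul_eq_lintegral {n m : ℕ} (hn : 1 ≤ n) (g : Fin n → Fin m) (s : Fin m → ℝ≥0) :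
    ∏ i, ((∑ j, (s j : ℝ≥0∞))⁻¹ * s (g i)) =
      ∫⁻ u in Ioi (0 : ℝ), ENNReal.ofReal (u ^ (n - 1) / Real.Gamma n) *
        ∏ j, ENNReal.ofReal (Real.exp (-u * s j) * (s j : ℝ) ^ fiberCard g j) := by
  have hfac : ∀ u : ℝ, ∏ j, ENNReal.ofReal (Real.exp (-u * s j) * (s j : ℝ) ^ fiberCard g j) =
      ENNReal.ofReal (Real.exp (-u * ∑ j, (s j : ℝ))) * ∏ i, (s (g i) : ℝ≥0∞) := by
    intro u
    rw [prod_comp_eq_prod_pow_fiberCard g fun j => (s j : ℝ≥0∞), Finset.mul_sum, Real.exp_sum,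
      ENNReal.ofReal_prod_of_nonneg fun _ _ => (Real.exp_pos _).le, ← Finset.prod_mul_distrib]
    refine Finset.prod_congr rfl fun j _ => ?_
    rw [ENNReal.ofReal_mul (Real.exp_pos _).le, ENNReal.ofReal_pow (s j).coe_nonneg,
      ENNReal.ofReal_coe_nnreal]
  have hprod : ∏ i, (s (g i) : ℝ≥0∞) ≠ ∞ := ENNReal.prod_ne_top fun _ _ => ENNReal.coe_ne_top
  simp only [hfac, ← mul_assoc]
  rw [lintegral_mul_const' _ _ hprod, Finset.prod_mul_distrib, Finset.prod_const,
    Finset.card_univ, Fintype.card_fin]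
  -- If all marks vanish, both sides are 0: since n ≥ 1, the product of marks has a zero factor,
  -- which absorbs the infinite inverse.
  rcases eq_or_ne (∑ j, s j) 0 with h0 | h0
  · have : ∏ i, (s (g i) : ℝ≥0∞) = 0 := by
      refine Finset.prod_eq_zero (Finset.mem_univ ⟨0, hn⟩) ?_
      simpa using (Finset.sum_eq_zero_iff.mp h0) (g ⟨0, hn⟩) (Finset.mem_univ _)
    simp [this]
  · have hT : (0 : ℝ) < ∑ j, (s j : ℝ) := by
      rw [← NNReal.coe_sum]
      exact_mod_cast pos_iff_ne_zero.mpr h0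
    rw [lintegral_pow_mul_exp_neg_div_Gamma hn hT, ← NNReal.coe_sum, ENNReal.ofReal_coe_nnreal,
      ENNReal.ofNNReal_finsetSum]

variable {Ω : Type*} [MeasurableSpace Ω]

theorem lintegral_prod_inv_mul {P : Measure Ω} [IsProbabilityMeasure P] {H : Measure ℝ≥0}
    {S : ℕ → Ω → ℝ≥0} (hS : ∀ j, Measurable (S j)) (hH : ∀ j, P.map (S j) = H)
    (hind : iIndepFun S P) {n m : ℕ} (hn : 1 ≤ n) (g : Fin n → Fin m) :
    ∫⁻ ω, ∏ i, ((∑ j : Fin m, (S j ω : ℝ≥0∞))⁻¹ * S (g i) ω) ∂P =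
      mixingWeight H n (fiberCard g) 0 := by
  have hmeas : ∀ (u : ℝ) (c : ℕ), Measurable fun s : ℝ≥0 =>
      ENNReal.ofReal (Real.exp (-u * s) * (s : ℝ) ^ c) := by
    intro u c
    fun_prop
  simp only [prod_inv_mul_eq_lintegral hn g fun j => S j _]
  rw [lintegral_lintegral_swap]
  · refine lintegral_congr fun u => ?_
    rw [pow_zero, mul_one, lintegral_const_mul]
    · congr 1
      have hind' : iIndepFun (fun j : Fin m => (fun s : ℝ≥0 =>
          ENNReal.ofReal (Real.exp (-u * s) * (s : ℝ) ^ fiberCard g j)) ∘ S j) P :=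
        (hind.precomp Fin.val_injective).comp _ fun j => hmeas u _
      refine (lintegral_prod_eq_prod_lintegral_of_indepFun Finset.univ _ hind'
        fun j => (hmeas u _).comp (hS j)).trans ?_
      refine Finset.prod_congr rfl fun j _ => ?_
      rw [kappa, ← hH j, lintegral_map (hmeas u _) (hS j)]
      rfl
    · exact Finset.measurable_fun_prod _ fun j _ => (hmeas u _).comp (hS j)
  · have hS' : ∀ j : Fin m, Measurable (S j) := fun j => hS j
    refine Measurable.aemeasurable ?_
    simp only [Function.uncurry_def]
    fun_prop

theorem kappa_zero (H : Measure ℝ≥0) (u : ℝ) : kappa H u 0 = psi H u := by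
  simp [kappa, psi]

/-- The m - k labels outside the range of e have empty fibres, and each contributes κ(u, 0) = ψ(u).
-/
theorem mixingWeight_fiberCard_comp (H : Measure ℝ≥0) {n k m : ℕ} {e : Fin k → Fin m}
    (he : Function.Injective e) (f : Fin n → Fin k) :
    mixingWeight H n (fiberCard (e ∘ f)) 0 = mixingWeight H n (fiberCard f) (m - k) := by
  classical
  have h1 : ∀ j, fiberCard (e ∘ f) (e j) = fiberCard f j := by
    intro j
    simp [fiberCard, he.eq_iff]
  have h2 : ∀ i ∉ Finset.univ.image e, fiberCard (e ∘ f) i = 0 := by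
    intro i hi
    simp only [Finset.mem_image, Finset.mem_univ, true_and, not_exists] at hi
    simp [fiberCard, hi]
  refine lintegral_congr fun u => ?_
  rw [pow_zero, mul_one, mul_assoc]
  congr 1
  rw [← Finset.prod_mul_prod_compl (Finset.univ.image e), Finset.prod_image he.injOn, mul_comm]
  congr 1
  · rw [Finset.prod_congr rfl (g := fun _ => psi H u), Finset.prod_const, Finset.card_compl,
      Finset.card_image_of_injective _ he]
    · simp
    · intro i hi
      rw [h2 i (Finset.mem_compl.mp hi), kappa_zero]
  · simp only [h1]

theorem mixingWeight_comp_perm (H : Measure ℝ≥0) (n : ℕ) {k : ℕ} (σ : Equiv.Perm (Fin k))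
    (c : Fin k → ℕ) (r : ℕ) : mixingWeight H n (c ∘ σ) r = mixingWeight H n c r := by
  refine lintegral_congr fun u => ?_
  congr 1
  exact Equiv.prod_comp σ fun j => kappa H u (c j)

end Marks

/-! ### Splitting index maps into labels and partitions -/

section Combinatorics

open Classical in
theorem sum_ite_distinctValuesMem {Z : Type*} {n k m : ℕ} {z : Fin m → Z}
    (hz : Function.Injective z) (B : Set (Fin k → Z)) (F : (Fin n → Fin m) → ℝ≥0∞) :
    (∑ g : Fin n → Fin m, if DistinctValuesMem k B (z ∘ g) then F g else 0) =
      ∑ e : Fin k → Fin m with Function.Injective e,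
        ∑ f : Fin n → Fin k with IsOrderedSurjection f, if z ∘ e ∈ B then F (e ∘ f) else 0 := by
  rw [← Finset.sum_product', ← Finset.sum_filter, ← Finset.sum_filter]
  symm
  refine Finset.sum_bij (fun q _ => q.1 ∘ q.2) ?_ ?_ ?_ ?_
  · rintro ⟨e, f⟩ h
    simp only [Finset.mem_product, Finset.mem_filter, Finset.mem_univ, true_and] at h ⊢
    exact (distinctValuesMem_iff_exists_comp _ _).mpr
      ⟨z ∘ e, h.2, hz.comp h.1.1, f, h.1.2, rfl⟩
  · rintro ⟨e, f⟩ h ⟨e', f'⟩ h' heq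
    simp only [Finset.mem_product, Finset.mem_filter, Finset.mem_univ, true_and] at h h'
    obtain ⟨h1, h2⟩ := comp_eq_comp_iff_of_isOrderedSurjection h.1.1 h'.1.1 h.1.2 h'.1.2 heq
    rw [h1, h2]
  · intro g hg
    simp only [Finset.mem_filter, Finset.mem_univ, true_and] at hg
    rw [distinctValuesMem_comp hz, distinctValuesMem_iff_exists_comp] at hg
    obtain ⟨e, heB, he, f, hf, rfl⟩ := hg
    refine ⟨(e, f), ?_, rfl⟩
    simp only [Finset.mem_product, Finset.mem_filter, Finset.mem_univ, true_and]
    exact ⟨⟨he, hf⟩, heB⟩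
  · intro q _
    rfl

end Combinatorics

/-! ### The law of the distinct values as a sum over labels -/

section Model

variable {Ω X : Type*} [MeasurableSpace X]

open Classical in
theorem indicator_pi_normalizedMeasure_distinctValuesMem [TopologicalSpace X] [PolishSpace X]
    [BorelSpace X] {N : Ω → ℕ} {x : ℕ → Ω → X} (S : ℕ → Ω → ℝ≥0) {n : ℕ} (hn : 1 ≤ n) {k : ℕ}
    {B : Set (Fin k → X)} (hB : MeasurableSet B) {ω : Ω}
    (hω : Set.InjOn (fun j => x j ω) (Set.Iio (N ω))) :
    {ω | 0 < randomMeasure N x S ω univ}.indicator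
        (fun ω => (Measure.pi fun _ => normalizedMeasure N x S ω)
          {y : Fin n → X | DistinctValuesMem k B y}) ω =
      ∑ e : Fin k → Fin (N ω) with Function.Injective e,
        ∑ f : Fin n → Fin k with IsOrderedSurjection f,
          if (fun i => x (e i) ω) ∈ B then
            ∏ i, ((∑ j : Fin (N ω), (S j ω : ℝ≥0∞))⁻¹ * S ((e ∘ f) i) ω) else 0 := by
  have hz : Function.Injective fun j : Fin (N ω) => x j ω := fun i j hij =>
    Fin.ext (hω i.2 j.2 hij)
  refine Eq.trans ?_ (sum_ite_distinctValuesMem hz B fun g : Fin n → Fin (N ω) =>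
    ∏ i, ((∑ j : Fin (N ω), (S j ω : ℝ≥0∞))⁻¹ * S (g i) ω))
  by_cases hT : 0 < randomMeasure N x S ω univ
  · rw [Set.indicator_of_mem (s := {ω | 0 < randomMeasure N x S ω univ}) hT,
      pi_normalizedMeasure n N x S hT]
    simp only [Measure.finsetSum_apply, Measure.smul_apply, smul_eq_mul,
      Measure.dirac_apply' _ (measurableSet_distinctValuesMem (n := n) hB)]
    refine Finset.sum_congr rfl fun g _ => ?_
    simp only [Set.indicator_apply, Pi.one_apply, mul_ite, mul_one, mul_zero]
    rfl
  · rw [Set.indicator_of_notMem (s := {ω | 0 < randomMeasure N x S ω univ}) hT]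
    symm
    -- With zero total mass every weight contains a zero mark, as n ≥ 1, so the formula needs no
    -- case distinction.
    refine Finset.sum_eq_zero fun g _ => ?_
    rw [not_lt, nonpos_iff_eq_zero, randomMeasure_univ] at hT
    have := (Finset.sum_eq_zero_iff.mp hT) (g ⟨0, hn⟩) (Finset.mem_univ _)
    rw [Finset.prod_eq_zero (Finset.mem_univ ⟨0, hn⟩) (by rw [this, mul_zero]), ite_self]

variable [MeasurableSpace Ω]

theorem lintegral_eq_tsum_setLIntegral_fiber {P : Measure Ω} {N : Ω → ℕ} (hN : Measurable N)
    (F : Ω → ℝ≥0∞) : ∫⁻ ω, F ω ∂P = ∑' m, ∫⁻ ω in {ω | N ω = m}, F ω ∂P := by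
  have hm : ∀ m, MeasurableSet {ω | N ω = m} := fun m => hN (measurableSet_singleton m)
  rw [← lintegral_iUnion hm]
  · rw [← setLIntegral_univ]
    congr 2
    ext ω
    simp
  · intro i j hij
    exact Set.disjoint_left.mpr fun ω hi hj => hij (hi.symm.trans hj)

theorem setLIntegral_powerProcess {P : Measure Ω} {k : ℕ} {N : Ω → ℕ} {x : ℕ → Ω → X}
    (hN : Measurable N) (hx : ∀ j, Measurable (x j)) {B : Set (Fin k → X)} (hB : MeasurableSet B)
    (A : Set Ω) (hA : MeasurableSet A) :
    ∫⁻ ω in A, powerProcess k N x ω B ∂P =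
      ∑' m, ∑ e : Fin k → Fin m, P (({ω | N ω = m} ∩ A) ∩ {ω | (fun i => x (e i) ω) ∈ B}) := by
  rw [lintegral_eq_tsum_setLIntegral_fiber hN]
  refine tsum_congr fun m => ?_
  have hm : MeasurableSet {ω | N ω = m} := hN (measurableSet_singleton m)
  have hxe : ∀ e : Fin k → Fin m, MeasurableSet {ω | (fun i => x (e i) ω) ∈ B} := fun e =>
    (measurable_pi_lambda _ fun i => hx (e i)) hB
  rw [Measure.restrict_restrict hm]
  have : ∀ ω ∈ {ω | N ω = m} ∩ A, powerProcess k N x ω B =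
      ∑ e : Fin k → Fin m, {ω | (fun i => x (e i) ω) ∈ B}.indicator 1 ω := by
    rintro ω ⟨rfl, -⟩
    rw [powerProcess_eq, Measure.finsetSum_apply]
    refine Finset.sum_congr rfl fun e _ => ?_
    rw [Measure.dirac_apply' _ hB]
    rfl
  rw [setLIntegral_congr_fun (hm.inter hA) this, lintegral_finsetSum]
  · refine Finset.sum_congr rfl fun e _ => ?_
    rw [lintegral_indicator_one (hxe e), Measure.restrict_apply (hxe e), inter_comm]
  · exact fun e _ => measurable_one.indicator (hxe e)

open Classical in
-- Simplicity makes x ∘ e have distinct entries exactly when e is injective, and the total mass of Φ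
-- reads off N.
theorem setLIntegral_powerProcess_injective [TopologicalSpace X] [PolishSpace X] [BorelSpace X]
    {P : Measure Ω} {k : ℕ} {N : Ω → ℕ} {x : ℕ → Ω → X}
    (hN : Measurable N) (hx : ∀ j, Measurable (x j))
    (hsimple : ∀ᵐ ω ∂P, Set.InjOn (fun j => x j ω) (Set.Iio (N ω)))
    {B : Set (Fin k → X)} (hB : MeasurableSet B) (m : ℕ) :
    ∫⁻ ω in {ω | pointProcess N x ω ∈ {ν : Measure X | ν univ = m}},
        powerProcess k N x ω (B ∩ {y | Function.Injective y}) ∂P =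
      ∑ e : Fin k → Fin m with Function.Injective e,
        P ({ω | N ω = m} ∩ {ω | (fun i => x (e i) ω) ∈ B}) := by
  have hA : {ω | pointProcess N x ω ∈ {ν : Measure X | ν univ = m}} = {ω | N ω = m} := by
    ext ω
    simp [pointProcess_univ]
  have hm : MeasurableSet {ω | N ω = m} := hN (measurableSet_singleton m)
  rw [hA, setLIntegral_powerProcess hN hx (hB.inter measurableSet_injective) _ hm, tsum_eq_single m]
  · rw [Finset.sum_filter]
    refine Finset.sum_congr rfl fun e _ => ?_
    rw [inter_self]
    split_ifs with he
    · refine measure_congr ?_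
      filter_upwards [hsimple] with ω hω
      refine propext ⟨fun h => ⟨h.1, h.2.1⟩, fun h => ⟨h.1, h.2, ?_⟩⟩
      have h1 : N ω = m := h.1
      intro i j hij
      exact he (Fin.ext (hω (by simp [h1]) (by simp [h1]) hij))
    · refine measure_mono_null ?_ measure_empty
      rintro ω ⟨-, -, h⟩
      exact he fun i j hij => h (by simp only [hij])
  · intro m' hm'
    refine Finset.sum_eq_zero fun e _ => measure_mono_null ?_ measure_empty
    rintro ω ⟨⟨h1, h2⟩, -⟩
    exact hm' (h1.symm.trans h2)

theorem measurable_prod_inv_mul {S : ℕ → Ω → ℝ≥0} (hS : ∀ j, Measurable (S j)) {n m : ℕ}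
    (g : Fin n → Fin m) :
    Measurable fun ω => ∏ i, ((∑ j : Fin m, (S j ω : ℝ≥0∞))⁻¹ * S (g i) ω) := by
  fun_prop

theorem measurableSet_card_eq_inter {k : ℕ} {N : Ω → ℕ} {x : ℕ → Ω → X} (hN : Measurable N)
    (hx : ∀ j, Measurable (x j)) {B : Set (Fin k → X)} (hB : MeasurableSet B) {m : ℕ}
    (e : Fin k → Fin m) :
    MeasurableSet ({ω | N ω = m} ∩ {ω | (fun i => x (e i) ω) ∈ B}) :=
  (hN (measurableSet_singleton m)).inter ((measurable_pi_lambda _ fun i => hx (e i)) hB)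

theorem IsMarkedPointProcess.lintegral_indicator_mul {P : Measure Ω} [IsProbabilityMeasure P]
    {H : Measure ℝ≥0} {N : Ω → ℕ} {x : ℕ → Ω → X} {S : ℕ → Ω → ℝ≥0}
    (hΨ : IsMarkedPointProcess P H N x S) {n : ℕ} (hn : 1 ≤ n) {k m : ℕ} {B : Set (Fin k → X)}
    (hB : MeasurableSet B) (e : Fin k → Fin m) (g : Fin n → Fin m) :
    ∫⁻ ω, ({ω | N ω = m} ∩ {ω | (fun i => x (e i) ω) ∈ B}).indicator 1 ω *
        ∏ i, ((∑ j : Fin m, (S j ω : ℝ≥0∞))⁻¹ * S (g i) ω) ∂P =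
      P ({ω | N ω = m} ∩ {ω | (fun i => x (e i) ω) ∈ B}) * mixingWeight H n (fiberCard g) 0 := by
  have hE := measurableSet_card_eq_inter hΨ.measurable_card hΨ.measurable_point hB e
  rw [← lintegral_prod_inv_mul hΨ.measurable_mark hΨ.law_mark hΨ.indep_marks hn g,
    ← lintegral_indicator_one hE]
  refine lintegral_mul_eq_lintegral_mul_lintegral_of_indepFun
    (measurable_one.indicator hE) (measurable_prod_inv_mul hΨ.measurable_mark g) ?_
  have hset : MeasurableSet {q : ℕ × (ℕ → X) | q.1 = m ∧ (fun i => q.2 (e i)) ∈ B} :=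
    (measurable_fst (measurableSet_singleton m)).inter
      ((measurable_pi_lambda _ fun i => (measurable_pi_apply _).comp measurable_snd) hB)
  have hind : Measurable ({q : ℕ × (ℕ → X) |
      q.1 = m ∧ (fun i => q.2 (e i)) ∈ B}.indicator (1 : ℕ × (ℕ → X) → ℝ≥0∞)) :=
    measurable_one.indicator hset
  exact hΨ.indep_points_marks.comp hind
    (measurable_prod_inv_mul (S := fun j (s : ℕ → ℝ≥0) => s j) (fun j => measurable_pi_apply j) g)

open Classical in
theorem IsMarkedPointProcess.measure_sample_mem [TopologicalSpace X] [PolishSpace X]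
    [BorelSpace X] {P : Measure Ω} [IsProbabilityMeasure P] {H : Measure ℝ≥0} {N : Ω → ℕ}
    {x : ℕ → Ω → X} {S : ℕ → Ω → ℝ≥0} (hΨ : IsMarkedPointProcess P H N x S) {n : ℕ}
    (hn : 1 ≤ n) {Y : Fin n → Ω → X}
    (hY : IsConditionallyIIDSample P (normalizedMeasure N x S) Y)
    {k : ℕ} {B : Set (Fin k → X)} (hB : MeasurableSet B) :
    P {ω | 0 < randomMeasure N x S ω univ ∧ DistinctValuesMem k B (fun i => Y i ω)} =
      ∑' m, ∑ e : Fin k → Fin m with Function.Injective e,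
        P ({ω | N ω = m} ∩ {ω | (fun i => x (e i) ω) ∈ B}) *
          ∑ f : Fin n → Fin k with IsOrderedSurjection f,
            mixingWeight H n (fiberCard f) (m - k) := by
  have h := hY.measure_mem (measurable_normalizedMeasure hΨ.measurable_card hΨ.measurable_point
    hΨ.measurable_mark)
    (fun ω => ⟨(normalizedMeasure_univ_le N x S ω).trans_lt ENNReal.one_lt_top⟩)
    (measurableSet_distinctValuesMem (n := n) hB)
  simp only [normalizedMeasure_ne_zero_iff] at h
  have hTm : MeasurableSet {ω | 0 < randomMeasure N x S ω univ} :=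
    ((Measure.measurable_coe MeasurableSet.univ).comp (measurable_randomMeasure
      hΨ.measurable_card hΨ.measurable_point hΨ.measurable_mark)) measurableSet_Ioi
  refine h.trans ?_
  rw [← lintegral_indicator hTm, lintegral_eq_tsum_setLIntegral_fiber hΨ.measurable_card]
  refine tsum_congr fun m => ?_
  have hm : MeasurableSet {ω | N ω = m} := hΨ.measurable_card (measurableSet_singleton m)
  have hEG : ∀ (e : Fin k → Fin m) (g : Fin n → Fin m), Measurable fun ω =>
      ({ω | N ω = m} ∩ {ω | (fun i => x (e i) ω) ∈ B}).indicator 1 ω *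
        ∏ i, ((∑ j : Fin m, (S j ω : ℝ≥0∞))⁻¹ * S (g i) ω) := fun e g =>
    (measurable_one.indicator (measurableSet_card_eq_inter hΨ.measurable_card
      hΨ.measurable_point hB e)).mul (measurable_prod_inv_mul hΨ.measurable_mark g)
  have hpt : ∀ᵐ ω ∂P, {ω | N ω = m}.indicator
      ({ω | 0 < randomMeasure N x S ω univ}.indicator
        (fun ω => (Measure.pi fun _ => normalizedMeasure N x S ω)
          {y : Fin n → X | DistinctValuesMem k B y})) ω =
      ∑ e : Fin k → Fin m with Function.Injective e,
        ∑ f : Fin n → Fin k with IsOrderedSurjection f,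
          ({ω | N ω = m} ∩ {ω | (fun i => x (e i) ω) ∈ B}).indicator 1 ω *
            ∏ i, ((∑ j : Fin m, (S j ω : ℝ≥0∞))⁻¹ * S ((e ∘ f) i) ω) := by
    filter_upwards [hΨ.simple] with ω hω
    by_cases hNω : N ω = m
    · rw [Set.indicator_of_mem (s := {ω | N ω = m}) hNω,
        indicator_pi_normalizedMeasure_distinctValuesMem S hn hB hω]
      subst hNω
      refine Finset.sum_congr rfl fun e _ => Finset.sum_congr rfl fun f _ => ?_
      by_cases heB : (fun i => x (e i) ω) ∈ B
      · rw [if_pos heB, Set.indicator_of_mem (by exact ⟨rfl, heB⟩), Pi.one_apply, one_mul]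
      · rw [if_neg heB, Set.indicator_of_notMem fun h => heB h.2, zero_mul]
    · rw [Set.indicator_of_notMem (s := {ω | N ω = m}) hNω]
      symm
      refine Finset.sum_eq_zero fun e _ => Finset.sum_eq_zero fun f _ => ?_
      rw [Set.indicator_of_notMem fun h => hNω h.1, zero_mul]
  rw [← lintegral_indicator hm, lintegral_congr_ae hpt,
    lintegral_finsetSum _ fun e _ => Finset.measurable_fun_sum _ fun f _ =>
      hEG e (e ∘ f)]
  refine Finset.sum_congr rfl fun e he => ?_
  rw [lintegral_finsetSum _ fun f _ => hEG e (e ∘ f),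
    Finset.mul_sum]
  refine Finset.sum_congr rfl fun f _ => ?_
  rw [hΨ.lintegral_indicator_mul hn hB e (e ∘ f),
    mixingWeight_fiberCard_comp H (Finset.mem_filter.mp he).2 f]

end Model

/-! ### Existence of Palm kernels -/

section Palm

variable {Ω X : Type*} [MeasurableSpace Ω] [MeasurableSpace X]

/-- A σ-finite first marginal is enough to disintegrate a measure on a product. -/
theorem exists_kernel_of_sigmaFinite_fst {α β : Type*} [MeasurableSpace α] [MeasurableSpace β]
    [StandardBorelSpace β] [Nonempty β] (C : Measure (α × β)) (hC : SigmaFinite C.fst) :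
    ∃ K : Kernel α β, IsMarkovKernel K ∧ ∀ B, MeasurableSet B → ∀ A, MeasurableSet A →
      C (B ×ˢ A) = ∫⁻ y in B, K y A ∂C.fst := by
  -- A positive density in the first coordinate makes C finite, so that it has a conditional kernel;
  -- the density is divided out at the end.
  obtain ⟨g, hg0, hgm, hg1⟩ := exists_pos_lintegral_lt_of_sigmaFinite C.fst one_ne_zero
  have hgm' : Measurable fun y => (g y : ℝ≥0∞) := hgm.coe_nnreal_ennreal
  have hfin : IsFiniteMeasure (C.withDensity fun q => (g q.1 : ℝ≥0∞)) := by
    refine ⟨?_⟩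
    rw [withDensity_apply _ MeasurableSet.univ, setLIntegral_univ]
    rw [Measure.fst, lintegral_map hgm' measurable_fst] at hg1
    exact hg1.trans ENNReal.one_lt_top
  have hfst : (C.withDensity fun q => (g q.1 : ℝ≥0∞)).fst =
      C.fst.withDensity fun y => (g y : ℝ≥0∞) := by
    ext B hB
    rw [Measure.fst_apply hB, withDensity_apply _ (measurable_fst hB), withDensity_apply _ hB,
      Measure.fst, setLIntegral_map hB hgm' measurable_fst]
  refine ⟨(C.withDensity fun q => (g q.1 : ℝ≥0∞)).condKernel, inferInstance, ?_⟩
  intro B hB A hA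
  set K := (C.withDensity fun q => (g q.1 : ℝ≥0∞)).condKernel with hK
  have hdis : (C.fst.withDensity fun y => (g y : ℝ≥0∞)) ⊗ₘ K =
      C.withDensity fun q => (g q.1 : ℝ≥0∞) := by
    rw [← hfst, hK]
    exact Measure.disintegrate _ _
  have hKA : Measurable fun y => K y A := K.measurable_coe hA
  have hsf : SFinite (C.fst.withDensity fun y => (g y : ℝ≥0∞)) := by
    rw [← hfst]
    infer_instance
  have h2 : ((C.restrict (Prod.snd ⁻¹' A)).map Prod.fst).withDensity (fun y => (g y : ℝ≥0∞)) =
      (C.fst.withDensity fun y => K y A).withDensity fun y => (g y : ℝ≥0∞) := by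
    ext D hD
    rw [withDensity_apply _ hD, setLIntegral_map hD hgm' measurable_fst,
      Measure.restrict_restrict (measurable_fst hD), ← Set.prod_eq,
      ← withDensity_apply _ (hD.prod hA), ← hdis, Measure.compProd_apply_prod hD hA,
      setLIntegral_withDensity_eq_setLIntegral_mul _ hgm' hKA hD,
      withDensity_apply _ hD, setLIntegral_withDensity_eq_setLIntegral_mul _ hKA hgm' hD]
    simp only [Pi.mul_apply, mul_comm]
  have h3 := congrArg (fun μ => μ.withDensity (fun y => (g y : ℝ≥0∞)⁻¹) B) h2
  have hne : ∀ y, (g y : ℝ≥0∞) ≠ 0 := fun y => by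
    exact_mod_cast (hg0 y).ne'
  rw [withDensity_inv_same hgm' (Filter.Eventually.of_forall hne)
      (Filter.Eventually.of_forall fun _ => ENNReal.coe_ne_top),
    withDensity_inv_same hgm' (Filter.Eventually.of_forall hne)
      (Filter.Eventually.of_forall fun _ => ENNReal.coe_ne_top),
    Measure.map_apply measurable_fst hB, Measure.restrict_apply (measurable_fst hB),
    ← Set.prod_eq, withDensity_apply _ hB] at h3
  exact h3

/-- The Campbell measure is lifted to the configurations in ℕ × (ℕ → X), a standard Borel space. Its
disintegration is then pushed forward to measures on X. -/
theorem exists_isPalmKernel [TopologicalSpace X] [PolishSpace X] [BorelSpace X] [Nonempty X]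
    {P : Measure Ω} {k : ℕ} {N : Ω → ℕ} {x : ℕ → Ω → X} (hN : Measurable N)
    (hx : ∀ j, Measurable (x j)) (hM : SigmaFinite (momentMeasure P k N x)) :
    ∃ palm : Kernel (Fin k → X) (Measure X), IsPalmKernel P k N x palm := by
  set C : Measure ((Fin k → X) × (ℕ × (ℕ → X))) := Measure.sum fun m =>
    ∑ e : Fin k → Fin m, (P.restrict {ω | N ω = m}).map
      fun ω => ((fun i => x (e i) ω), (N ω, fun j => x j ω)) with hCdef
  have hξ : Measurable fun ω => (N ω, fun j => x j ω) :=
    hN.prodMk (measurable_pi_lambda _ hx)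
  have hCB : ∀ B : Set (Fin k → X), MeasurableSet B → ∀ A : Set (ℕ × (ℕ → X)), MeasurableSet A →
      C (B ×ˢ A) =
        ∫⁻ ω in {ω | (N ω, fun j => x j ω) ∈ A}, powerProcess k N x ω B ∂P := by
    intro B hB A hA
    have hA' : MeasurableSet {ω | (N ω, fun j => x j ω) ∈ A} := hξ hA
    rw [setLIntegral_powerProcess hN hx hB _ hA', hCdef, Measure.sum_apply _ (hB.prod hA)]
    refine tsum_congr fun m => ?_
    rw [Measure.finsetSum_apply]
    refine Finset.sum_congr rfl fun e _ => ?_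
    have hmap : Measurable fun ω => ((fun i => x (e i) ω), (N ω, fun j => x j ω)) :=
      (measurable_pi_lambda _ fun i => hx (e i)).prodMk hξ
    rw [Measure.map_apply hmap (hB.prod hA), Measure.restrict_apply (hmap (hB.prod hA))]
    congr 1
    ext ω
    simp only [mem_inter_iff, mem_preimage, mem_prod, mem_ofPred_eq]
    tauto
  have hfst : C.fst = momentMeasure P k N x := by
    ext B hB
    rw [Measure.fst_apply hB, momentMeasure_apply hN hx hB, ← Set.prod_univ,
      hCB B hB univ MeasurableSet.univ]
    simp
  obtain ⟨K, hK, hKC⟩ := exists_kernel_of_sigmaFinite_fst C (hfst ▸ hM)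
  have hconf : Measurable (pointProcess (Prod.fst : ℕ × (ℕ → X) → ℕ) fun j q => q.2 j) :=
    measurable_pointProcess measurable_fst fun j => (measurable_pi_apply j).comp measurable_snd
  refine ⟨K.map (pointProcess Prod.fst fun j q => q.2 j), Kernel.IsMarkovKernel.map K hconf, ?_⟩
  intro B hB L hL
  simp only [Kernel.map_apply' K hconf _ hL]
  rw [← hfst, ← hKC B hB _ (hconf hL), hCB B hB _ (hconf hL)]
  rfl

end Palm

/-! ### Counting points under the reduced Palm distribution -/

section ReducedPalm

variable {Ω X : Type*} [MeasurableSpace Ω] [MeasurableSpace X]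

theorem IsPalmKernel.ae_eq_zero {P : Measure Ω} {k : ℕ} {N : Ω → ℕ} {x : ℕ → Ω → X}
    {palm : Kernel (Fin k → X) (Measure X)} (hpalm : IsPalmKernel P k N x palm)
    (hN : Measurable N) (hx : ∀ j, Measurable (x j))
    {B : Set (Fin k → X)} (hB : MeasurableSet B) {L : Set (Measure X)} (hL : MeasurableSet L)
    (h : ∀ ω, pointProcess N x ω ∈ L → powerProcess k N x ω B = 0) :
    ∀ᵐ y ∂momentMeasure P k N x, y ∈ B → palm y L = 0 := by
  have h0 := hpalm.disintegration B hB L hL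
  have hLm : MeasurableSet {ω | pointProcess N x ω ∈ L} := measurable_pointProcess hN hx hL
  rw [setLIntegral_congr_fun (g := 0) hLm fun ω hω => h ω hω, Pi.zero_def, lintegral_zero,
    eq_comm, lintegral_eq_zero_iff (palm.measurable_coe hL)] at h0
  exact (ae_restrict_iff' hB).mp h0

theorem one_le_measure_singleton [TopologicalSpace X] [PolishSpace X] [BorelSpace X]
    {ν : Measure X} [IsFiniteMeasure ν] {z : X}
    (h : ∀ U ∈ TopologicalSpace.countableBasis X, z ∈ U → 1 ≤ ν U) : 1 ≤ ν {z} := by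
  let _ := TopologicalSpace.upgradeIsCompletelyMetrizable X
  rw [Set.measure_eq_iInf_isOpen]
  refine le_iInf₂ fun V hzV => le_iInf fun hV => ?_
  obtain ⟨U, hU, hzU, hUV⟩ := (TopologicalSpace.isBasis_countableBasis X).exists_subset_of_mem_open
    (hzV rfl) hV
  exact (h U hU hzU).trans (measure_mono hUV)

theorem sum_dirac_le [MeasurableSingletonClass X] {k : ℕ} {y : Fin k → X}
    (hy : Function.Injective y) {ν : Measure X} (h : ∀ j, 1 ≤ ν {y j}) :
    ∑ j, Measure.dirac (y j) ≤ ν := by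
  classical
  refine Measure.le_iff.mpr fun s hs => ?_
  rw [Measure.finsetSum_apply]
  calc ∑ j, Measure.dirac (y j) s
      = ∑ j with y j ∈ s, (1 : ℝ≥0∞) := by
        simp [Measure.dirac_apply' _ hs, Set.indicator_apply]
    _ ≤ ∑ j with y j ∈ s, ν {y j} := Finset.sum_le_sum fun j _ => h j
    _ = ν (⋃ j ∈ Finset.univ.filter fun j => y j ∈ s, {y j}) := by
        refine (measure_biUnion_finset ?_ fun _ _ => measurableSet_singleton _).symm
        intro i _ j _ hij
        exact Set.disjoint_singleton.mpr (hy.ne hij)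
    _ ≤ ν s := by
        refine measure_mono (Set.iUnion₂_subset fun j hj => ?_)
        simpa using hj

theorem sub_sum_dirac_univ_eq_iff {k : ℕ} {y : Fin k → X} {ν : Measure X} [IsFiniteMeasure ν]
    (h : ∑ j, Measure.dirac (y j) ≤ ν) (r : ℕ) :
    (ν - ∑ j, Measure.dirac (y j)) univ = r ↔ ν univ = (r + k : ℕ) := by
  have hk : (∑ j, Measure.dirac (y j) : Measure X) univ = k := by simp
  have : IsFiniteMeasure (∑ j, Measure.dirac (y j) : Measure X) := ⟨by simp [hk]⟩
  have hle := h univ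
  rw [Measure.sub_apply MeasurableSet.univ h, hk]
  rw [hk] at hle
  constructor
  · intro h'
    rw [← tsub_add_cancel_of_le hle, h']
    push_cast
    rfl
  · intro h'
    rw [h']
    push_cast
    exact ENNReal.add_sub_cancel_right (ENNReal.natCast_ne_top k)

/-- If Φ^k charges {y_j ∈ U}, then Φ(U) ≥ 1. The disintegration transfers this to Palm measures,
simultaneously for all U in a countable basis, and shrinking U gives mass at least 1 at each y_j.
For distinct y_j the subtraction is then a genuine one, lowering the total mass by k. -/
theorem IsPalmKernel.ae_reducedPalmCount_eq [TopologicalSpace X] [PolishSpace X] [BorelSpace X]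
    {P : Measure Ω} {k : ℕ} {N : Ω → ℕ} {x : ℕ → Ω → X}
    {palm : Kernel (Fin k → X) (Measure X)} (hpalm : IsPalmKernel P k N x palm)
    (hN : Measurable N) (hx : ∀ j, Measurable (x j)) :
    ∀ᵐ y ∂momentMeasure P k N x, Function.Injective y → ∀ r : ℕ,
      reducedPalmCount palm y r = palm y {ν | ν univ = (r + k : ℕ)} := by
  have hfin : ∀ᵐ y ∂momentMeasure P k N x, y ∈ univ → palm y {ν | ν univ = ∞} = 0 := by
    refine hpalm.ae_eq_zero hN hx MeasurableSet.univ
      (Measure.measurable_coe MeasurableSet.univ (measurableSet_singleton _)) fun ω hω => ?_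
    simp [pointProcess_univ] at hω
  have hatom : ∀ᵐ y ∂momentMeasure P k N x, ∀ U ∈ TopologicalSpace.countableBasis X, ∀ j,
      y ∈ {y : Fin k → X | y j ∈ U} → palm y {ν | ν U < 1} = 0 := by
    refine (ae_ball_iff (TopologicalSpace.countable_countableBasis X)).mpr fun U hU =>
      ae_all_iff.mpr fun j => ?_
    have hUm : MeasurableSet U := (TopologicalSpace.isOpen_of_mem_countableBasis hU).measurableSet
    have hjU : MeasurableSet {y : Fin k → X | y j ∈ U} := measurable_pi_apply j hUm
    refine hpalm.ae_eq_zero hN hx hjU (Measure.measurable_coe hUm measurableSet_Iio)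
      fun ω hω => ?_
    rw [powerProcess_eq, Measure.finsetSum_apply]
    refine Finset.sum_eq_zero fun e _ => ?_
    rw [Measure.dirac_apply' _ hjU, Set.indicator_of_notMem]
    intro hmem
    refine not_le.mpr (show pointProcess N x ω U < 1 from hω) ?_
    rw [pointProcess, Finset.sum_range, Measure.finsetSum_apply]
    refine le_trans ?_ (Finset.single_le_sum (fun _ _ => zero_le) (Finset.mem_univ (e j)))
    rw [Measure.dirac_apply' _ hUm, Set.indicator_of_mem (s := U) hmem, Pi.one_apply]
  filter_upwards [hfin, hatom] with y hy1 hy2 hinj r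
  -- Almost sure equality of the two events suffices, so measurability of ν ↦ ν - ∑ δ_{y_j} is not
  -- needed.
  refine measure_congr ?_
  have h1 : ∀ᵐ ν ∂palm y, ν univ ≠ ∞ := by
    simpa [ae_iff] using hy1 (mem_univ y)
  have h2 : ∀ᵐ ν ∂palm y, ∀ U ∈ TopologicalSpace.countableBasis X, ∀ j, y j ∈ U → 1 ≤ ν U := by
    refine (ae_ball_iff (TopologicalSpace.countable_countableBasis X)).mpr fun U hU =>
      ae_all_iff.mpr fun j => ?_
    by_cases hj : y j ∈ U
    · simpa [ae_iff, hj] using hy2 U hU j hj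
    · simp [hj]
  filter_upwards [h1, h2] with ν hν1 hν2
  have : IsFiniteMeasure ν := ⟨lt_top_iff_ne_top.mpr hν1⟩
  exact propext (sub_sum_dirac_univ_eq_iff
    (sum_dirac_le hinj fun j => one_le_measure_singleton fun U hU => hν2 U hU j) r)

open Classical in
theorem IsPalmKernel.setLIntegral_reducedPalmCount [TopologicalSpace X] [PolishSpace X]
    [BorelSpace X] {P : Measure Ω} {k : ℕ} {N : Ω → ℕ} {x : ℕ → Ω → X}
    {palm : Kernel (Fin k → X) (Measure X)} (hpalm : IsPalmKernel P k N x palm)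
    (hN : Measurable N) (hx : ∀ j, Measurable (x j))
    (hsimple : ∀ᵐ ω ∂P, Set.InjOn (fun j => x j ω) (Set.Iio (N ω)))
    {B : Set (Fin k → X)} (hB : MeasurableSet B) (A : ℕ → ℝ≥0∞) :
    ∫⁻ y in B ∩ {y | Function.Injective y}, ∑' r, A r * reducedPalmCount palm y r
        ∂momentMeasure P k N x =
      ∑' r, ∑ e : Fin k → Fin (r + k) with Function.Injective e,
        P ({ω | N ω = r + k} ∩ {ω | (fun i => x (e i) ω) ∈ B}) * A r := by
  have hBi := hB.inter (measurableSet_injective (X := X) (k := k))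
  have hL : ∀ r : ℕ, MeasurableSet {ν : Measure X | ν univ = (r + k : ℕ)} := fun r =>
    Measure.measurable_coe MeasurableSet.univ (measurableSet_singleton _)
  have hcongr : ∀ᵐ y ∂momentMeasure P k N x, y ∈ B ∩ {y | Function.Injective y} →
      ∑' r, A r * reducedPalmCount palm y r =
        ∑' r, A r * palm y {ν : Measure X | ν univ = (r + k : ℕ)} := by
    filter_upwards [hpalm.ae_reducedPalmCount_eq hN hx] with y hy hyB
    simp only [hy hyB.2]
  rw [setLIntegral_congr_fun_ae hBi hcongr,
    lintegral_tsum fun r => ((palm.measurable_coe (hL r)).const_mul _).aemeasurable]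
  refine tsum_congr fun r => ?_
  rw [lintegral_const_mul _ (palm.measurable_coe (hL r)),
    ← hpalm.disintegration _ hBi _ (hL r),
    setLIntegral_powerProcess_injective hN hx hsimple hB, mul_comm, Finset.sum_mul]

theorem tsum_eq_tsum_nat_add_of_eq_zero {F : ℕ → ℝ≥0∞} {k : ℕ} (hF : ∀ m < k, F m = 0) :
    ∑' m, F m = ∑' r, F (r + k) := by
  rw [← Summable.sum_add_tsum_nat_add' (k := k) ENNReal.summable,
    Finset.sum_eq_zero fun m hm => hF m (Finset.mem_range.mp hm), zero_add]

end ReducedPalm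

end NormalizedRandomMeasure

/-! ### The main theorem -/

open NormalizedRandomMeasure in
theorem mainTheorem5
    {Ω : Type*} [MeasurableSpace Ω] (P : Measure Ω) [IsProbabilityMeasure P]
    {X : Type*} [TopologicalSpace X] [PolishSpace X] [MeasurableSpace X] [BorelSpace X]
    (H : Measure ℝ≥0) [IsProbabilityMeasure H]
    (N : Ω → ℕ) (x : ℕ → Ω → X) (S : ℕ → Ω → ℝ≥0)
    (hΨ : IsMarkedPointProcess P H N x S)
    (n : ℕ) (hn : 1 ≤ n) (Y : Fin n → Ω → X)
    (hY : IsConditionallyIIDSample P (normalizedMeasure N x S) Y)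
    (k : ℕ) (hM : SigmaFinite (momentMeasure P k N x)) :
    (∃ palm : Kernel (Fin k → X) (Measure X), IsPalmKernel P k N x palm) ∧
    ∀ palm : Kernel (Fin k → X) (Measure X), IsPalmKernel P k N x palm →
      ∀ B : Set (Fin k → X), MeasurableSet B →
        P {ω | 0 < randomMeasure N x S ω univ ∧ DistinctValuesMem k B (fun i => Y i ω)} =
          ∫⁻ y in B ∩ {y | Function.Injective y},
            (k.factorial : ℝ≥0∞)⁻¹ *
              ∑' r : ℕ,
                (∑ c ∈ positiveCompositions n k,
                  (Nat.multinomial Finset.univ c : ℝ≥0∞) * mixingWeight H n c r) *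
                reducedPalmCount palm y r
            ∂(momentMeasure P k N x) := by
  classical
  obtain ⟨ω₀⟩ : Nonempty Ω := nonempty_of_isProbabilityMeasure P
  -- The unused value x 0 exists even when `N` is 0.
  have : Nonempty X := ⟨x 0 ω₀⟩
  refine ⟨exists_isPalmKernel hΨ.measurable_card hΨ.measurable_point hM, ?_⟩
  intro palm hpalm B hB
  have hk0 : (k.factorial : ℝ≥0∞) ≠ 0 := by exact_mod_cast k.factorial_ne_zero
  have hA : ∀ r, (k.factorial : ℝ≥0∞)⁻¹ * (∑ c ∈ positiveCompositions n k,
      (Nat.multinomial Finset.univ c : ℝ≥0∞) * mixingWeight H n c r) =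
      ∑ f : Fin n → Fin k with IsOrderedSurjection f, mixingWeight H n (fiberCard f) r := by
    intro r
    rw [sum_surjective_eq_sum_positiveCompositions fun c => mixingWeight H n c r,
      sum_surjective_eq_factorial_mul (fun c => mixingWeight H n c r) fun σ c =>
        mixingWeight_comp_perm H n σ c r, ← mul_assoc,
      ENNReal.inv_mul_cancel hk0 (ENNReal.natCast_ne_top _), one_mul]
  simp only [← ENNReal.tsum_mul_left, ← mul_assoc, hA]
  rw [hpalm.setLIntegral_reducedPalmCount hΨ.measurable_card hΨ.measurable_point hΨ.simple hB,
    hΨ.measure_sample_mem hn hY hB]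
  -- For m < k there is no injection Fin k → Fin m; the rest is reindexed by m = r + k.
  refine (tsum_eq_tsum_nat_add_of_eq_zero (k := k) fun m hm => ?_).trans ?_
  · refine Finset.sum_eq_zero fun e he => absurd hm (not_lt.mpr ?_)
    simpa using Fintype.card_le_of_injective e (Finset.mem_filter.mp he).2
  · simp only [Nat.add_sub_cancel]
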